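/- Let $m,k\ge 0$ be integers with $m\ge 2k$. Let the symmetric group $S_m$ act on $\mathbb{C}[x_1,\dots,x_m]$ by permuting the variables, and let $SF_{m,k}$ be the subrepresentation of the space of homogeneous polynomials of degree $k$ spanned by the square-free monomials $x_{i_1}\cdots x_{i_k}$, $i_1<\cdots<i_k$. For a partition $\lambda$ of $m$, denote by $[\lambda]$ the complex irreducible representation of $S_m$ defined by $\lambda$: it is the left ideal $\mathbb{C}[S_m]\,c_T$ of the group algebra, where $T$ is any numbering of the cells of the Young diagram of $\lambda$ by $1,\dots,m$ (each used once) and $c_T=\big(\sum_{g}g\big)\big(\sum_{h}\operatorname{sgn}(h)\,h\big)$ is its Young symmetrizer, with $g$ running over the permutations preserving each row of $T$ and $h$ over those preserving each column of $T$. Then $SF_{m,k}$ is multiplicity free (isomorphic irreducible subrepresentations of it are equal), and its decomposition into irreducible components is $$SF_{m,k}\;\simeq\;\bigoplus_{p=0}^{k}\,[m-p,p]$$ as representations of $S_m$, where the $[m-p,p]$, $0\le p\le k$, are irreducible and pairwise non-isomorphic. -/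

import Mathlib

namespace SymRep

noncomputable section

open MvPolynomial

/-- The representation of `S_m` on `ℂ[x_1, …, x_m]` by permutation of the variables:
`σ` sends `x_i` to `x_{σ i}`. -/
def permVars (m : ℕ) :
    Representation ℂ (Equiv.Perm (Fin m)) (MvPolynomial (Fin m) ℂ) where
  toFun σ := (rename σ : MvPolynomial (Fin m) ℂ →ₐ[ℂ] MvPolynomial (Fin m) ℂ).toLinearMap
  map_one' := by
    refine LinearMap.ext fun f => ?_
    simp [Equiv.Perm.coe_one]
  map_mul' σ τ := by
    refine LinearMap.ext fun f => ?_
    simp [rename_rename, Equiv.Perm.coe_mul]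

/-- The square-free monomial `∏_{i ∈ s} x_i`. -/
def sqFreeMonomial {m : ℕ} (s : Finset (Fin m)) : MvPolynomial (Fin m) ℂ :=
  ∏ i ∈ s, X i

/-- `SF_{m,k}`: the subrepresentation of `ℂ[x_1, …, x_m]` spanned by the square-free monomials
of degree `k`. -/
def SF (m k : ℕ) : Subrepresentation (permVars m) where
  toSubmodule := Submodule.span ℂ {f | ∃ s : Finset (Fin m), s.card = k ∧ f = sqFreeMonomial s}
  apply_mem_toSubmodule σ f hf := by
    refine Submodule.span_induction ?_ ?_ ?_ ?_ hf
    · rintro _ ⟨s, hs, rfl⟩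
      refine Submodule.subset_span ⟨s.map σ.toEmbedding, by simpa using hs, ?_⟩
      simp [permVars, sqFreeMonomial, map_prod]
    · simp
    · intro x y _ _ hx hy
      rw [map_add]
      exact Submodule.add_mem _ hx hy
    · intro a x _ hx
      rw [map_smul]
      exact Submodule.smul_mem _ a hx

/-- A numbering of the cells of the Young diagram `μ` by the `m` letters `0, …, m - 1`, each used
exactly once; `T i` is the cell containing the letter `i`. The first coordinate of a cell is the
index of its row, the second one is the index of its column. -/
abbrev Numbering (m : ℕ) (μ : YoungDiagram) : Type := Fin m ≃ μ.cells

variable {m : ℕ} {μ : YoungDiagram}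

/-- `a_T = ∑ g`, the sum over the permutations `g` which preserve each row of `T`. -/
def rowSymmetrizer (T : Numbering m μ) : MonoidAlgebra ℂ (Equiv.Perm (Fin m)) :=
  ∑ g : Equiv.Perm (Fin m) with ∀ i, (T (g i)).1.1 = (T i).1.1, MonoidAlgebra.single g 1

/-- `b_T = ∑ sgn(g) g`, the sum over the permutations `g` which preserve each column of `T`. -/
def colAntisymmetrizer (T : Numbering m μ) : MonoidAlgebra ℂ (Equiv.Perm (Fin m)) :=
  ∑ g : Equiv.Perm (Fin m) with ∀ i, (T (g i)).1.2 = (T i).1.2,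
    MonoidAlgebra.single g ((Equiv.Perm.sign g : ℤ) : ℂ)

/-- The Young symmetrizer `c_T = a_T b_T`. -/
def youngSymmetrizer (T : Numbering m μ) : MonoidAlgebra ℂ (Equiv.Perm (Fin m)) :=
  rowSymmetrizer T * colAntisymmetrizer T

/-- The representation `[μ]` of `S_m` defined by the partition `μ` of `m`, namely the left ideal
`ℂ[S_m] c_T` of the group algebra, where `T` is a numbering of `μ`. -/
def spechtModule (T : Numbering m μ) :
    Subrepresentation (Representation.leftRegular ℂ (Equiv.Perm (Fin m))) where
  toSubmodule := LinearMap.range (LinearMap.mulRight ℂ (youngSymmetrizer T))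
  apply_mem_toSubmodule g v hv := by
    have key (x : MonoidAlgebra ℂ (Equiv.Perm (Fin m))) :
        Representation.leftRegular ℂ (Equiv.Perm (Fin m)) g x = MonoidAlgebra.single g 1 * x := by
      induction x using MonoidAlgebra.induction_linear with
      | zero => simp
      | add x y hx hy => rw [map_add, hx, hy, mul_add]
      | single h r => simp [MonoidAlgebra.single_mul_single]
    obtain ⟨x, rfl⟩ := hv
    exact ⟨MonoidAlgebra.single g 1 * x, by simp [key, mul_assoc]⟩

/-- The Young diagram of the partition `(m - p, p)` of `m`, for `2 p ≤ m`. -/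
def twoRow (m p : ℕ) (h : 2 * p ≤ m) : YoungDiagram :=
  YoungDiagram.ofRowLens [m - p, p] (by
    simp only [List.sortedGE_iff_pairwise, List.pairwise_cons, List.mem_singleton]
    refine ⟨?_, by simp⟩
    rintro a rfl
    omega)

theorem card_twoRow (m p : ℕ) (h : 2 * p ≤ m) : (twoRow m p h).card = m := by
  have h0 : (twoRow m p h).cells = YoungDiagram.cellsOfRowLens [m - p, p] := rfl
  rw [YoungDiagram.card, h0]
  simp only [YoungDiagram.cellsOfRowLens]
  rw [Finset.card_union_of_disjoint]
  · simp; omega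
  · rw [Finset.disjoint_left]
    rintro ⟨a, b⟩ h1 h2
    simp at h1 h2
    omega

instance (m p : ℕ) (h : 2 * p ≤ m) : Nonempty (Numbering m (twoRow m p h)) :=
  ⟨((twoRow m p h).cells.equivFinOfCardEq (card_twoRow m p h)).symm⟩

/-- A (completely reducible) representation is multiplicity free if two isomorphic irreducible
subrepresentations are always equal. -/
def MultiplicityFree {k G V : Type*} [Field k] [Monoid G] [AddCommGroup V] [Module k V]
    (ρ : Representation k G V) : Prop :=
  ∀ σ τ : Subrepresentation ρ,
    σ.toRepresentation.IsIrreducible → τ.toRepresentation.IsIrreducible →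
      Nonempty (σ.toRepresentation.Equiv τ.toRepresentation) → σ = τ

end

end SymRep

/-! Write `c = a b` for the Young symmetrizer of a two-row numbering. A pigeonhole argument on
columns shows that `c x c` is always a multiple of `c`, and that `c_T x c_U = 0` for different
shapes (`youngSymmetrizer_mul_mul_mem`, `youngSymmetrizer_mul_mul_eq_zero`). Semisimplicity of the
group algebra then gives, for each nonzero `w` in `ℂ[S_m] c`, some `y` with `c y w = c`
(`exists_youngSymmetrizer_mul_mul_eq`). Irreducibility and pairwise non-isomorphism both follow from
this.

For `p ≤ k ≤ m - p`, the image `c SF` is exactly a line: straightening reduces every square-free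
monomial to one fixed monomial, whose image under `c` is nonzero. Acting on that monomial maps each
`[m - p, p]` to `SF`, and the elements `c y` separate the components, so the map from the direct sum
is injective. For surjectivity, the vectors of `SF` invariant under the stabilizer of a `k`-set `u`
form a space of dimension at most `k + 1`, since its orbits on `k`-sets are indexed by `|s ∩ u|`.
Each of the `k + 1` summands contributes a nonzero invariant, so all invariants lie in the image;
one of them is the monomial of `u`, which generates `SF`. Multiplicity freeness holds because
isomorphic irreducible subrepresentations both contain the line `c SF` for a suitable `c`. -/

namespace SymRep

open MvPolynomial

/-! ### Row and column symmetrizers in the group algebra. -/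

section Symmetrizers

variable {m : ℕ} {μ ν : YoungDiagram}

theorem apply_inv_eq {α β : Type*} {f : α → β} {t : Equiv.Perm α} (ht : ∀ i, f (t i) = f i) (i : α) :
    f (t⁻¹ i) = f i := by
  rw [← ht (t⁻¹ i), ← Equiv.Perm.mul_apply, mul_inv_cancel, Equiv.Perm.one_apply]

theorem eq_zero_of_eq_neg_self {V : Type*} [AddCommGroup V] [Module ℂ V] {v : V} (h : v = -v) :
    v = 0 := by
  have h2 : (2 : ℂ) • v = 0 := by
    rw [two_smul]
    nth_rewrite 1 [h]
    exact neg_add_cancel v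
  simpa using h2

theorem rowSymmetrizer_mul_single (T : Numbering m μ) (t : Equiv.Perm (Fin m))
    (ht : ∀ i, (T (t i)).1.1 = (T i).1.1) :
    rowSymmetrizer T * MonoidAlgebra.single t 1 = rowSymmetrizer T := by
  simp only [rowSymmetrizer, Finset.sum_mul, MonoidAlgebra.single_mul_single, mul_one]
  refine Finset.sum_equiv (Equiv.mulRight t) (fun g => ?_) (fun g _ => by simp)
  simp only [Finset.mem_filter, Finset.mem_univ, true_and, Equiv.coe_mulRight, Equiv.Perm.mul_apply]
  exact ⟨fun H i => (H _).trans (ht i), fun H i => by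
    have h1 := H (t⁻¹ i)
    rw [← Equiv.Perm.mul_apply t, mul_inv_cancel, Equiv.Perm.one_apply] at h1
    exact h1.trans (apply_inv_eq (f := fun x => (T x).1.1) ht i)⟩

theorem single_mul_rowSymmetrizer (T : Numbering m μ) (t : Equiv.Perm (Fin m))
    (ht : ∀ i, (T (t i)).1.1 = (T i).1.1) :
    MonoidAlgebra.single t 1 * rowSymmetrizer T = rowSymmetrizer T := by
  simp only [rowSymmetrizer, Finset.mul_sum, MonoidAlgebra.single_mul_single, mul_one]
  refine Finset.sum_equiv (Equiv.mulLeft t) (fun g => ?_) (fun g _ => by simp)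
  simp [ht]

theorem colAntisymmetrizer_mul_single (T : Numbering m μ) (t : Equiv.Perm (Fin m))
    (ht : ∀ i, (T (t i)).1.2 = (T i).1.2) :
    colAntisymmetrizer T * MonoidAlgebra.single t 1 =
      ((Equiv.Perm.sign t : ℤ) : ℂ) • colAntisymmetrizer T := by
  simp only [colAntisymmetrizer, Finset.sum_mul, MonoidAlgebra.single_mul_single, mul_one,
    Finset.smul_sum, MonoidAlgebra.smul_single, smul_eq_mul]
  refine Finset.sum_equiv (Equiv.mulRight t) (fun g => ?_) (fun g _ => ?_)
  · simp only [Finset.mem_filter, Finset.mem_univ, true_and, Equiv.coe_mulRight,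
      Equiv.Perm.mul_apply]
    exact ⟨fun H i => (H _).trans (ht i), fun H i => by
      have h1 := H (t⁻¹ i)
      rw [← Equiv.Perm.mul_apply t, mul_inv_cancel, Equiv.Perm.one_apply] at h1
      exact h1.trans (apply_inv_eq (f := fun x => (T x).1.2) ht i)⟩
  · rcases Int.units_eq_one_or (Equiv.Perm.sign t) with h | h <;> simp [h]

theorem single_mul_colAntisymmetrizer (T : Numbering m μ) (t : Equiv.Perm (Fin m))
    (ht : ∀ i, (T (t i)).1.2 = (T i).1.2) :
    MonoidAlgebra.single t 1 * colAntisymmetrizer T =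
      ((Equiv.Perm.sign t : ℤ) : ℂ) • colAntisymmetrizer T := by
  simp only [colAntisymmetrizer, Finset.mul_sum, MonoidAlgebra.single_mul_single, one_mul,
    Finset.smul_sum, MonoidAlgebra.smul_single, smul_eq_mul]
  refine Finset.sum_equiv (Equiv.mulLeft t) (fun g => ?_) (fun g _ => ?_)
  · simp [ht]
  · rcases Int.units_eq_one_or (Equiv.Perm.sign t) with h | h <;> simp [h]

theorem apply_swap_eq {α β : Type*} [DecidableEq α] (f : α → β) {i j : α} (h : f i = f j) (x : α) :
    f (Equiv.swap i j x) = f x := by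
  rw [Equiv.swap_apply_def]
  split_ifs with h1 h2
  · rw [h1, h]
  · rw [h2, h]
  · rfl

theorem single_mul_single_swap (g : Equiv.Perm (Fin m)) (i j : Fin m) :
    (MonoidAlgebra.single (Equiv.swap (g i) (g j)) 1 * MonoidAlgebra.single g 1 :
      MonoidAlgebra ℂ (Equiv.Perm (Fin m))) =
      MonoidAlgebra.single g 1 * MonoidAlgebra.single (Equiv.swap i j) 1 := by
  rw [MonoidAlgebra.single_mul_single, MonoidAlgebra.single_mul_single]
  congr 1
  rw [Equiv.mul_swap_eq_swap_mul]

/-- The transposition `(g i g j)` is absorbed by the row symmetrizer; carried across `g` it becomes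
`(i j)`, which the column antisymmetrizer absorbs with sign `-1`. The product thus equals its own
negative. -/
theorem rowSymmetrizer_mul_single_mul_colAntisymmetrizer (T : Numbering m μ) (U : Numbering m ν)
    (g : Equiv.Perm (Fin m)) {i j : Fin m} (hij : i ≠ j) (hc : (U i).1.2 = (U j).1.2)
    (hr : (T (g i)).1.1 = (T (g j)).1.1) :
    rowSymmetrizer T * MonoidAlgebra.single g 1 * colAntisymmetrizer U = 0 := by
  apply eq_zero_of_eq_neg_self
  conv_lhs =>
    rw [← rowSymmetrizer_mul_single T (Equiv.swap (g i) (g j))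
      (apply_swap_eq (fun x => (T x).1.1) hr), mul_assoc (rowSymmetrizer T),
      single_mul_single_swap, ← mul_assoc, mul_assoc _ _ (colAntisymmetrizer U),
      single_mul_colAntisymmetrizer U _ (apply_swap_eq (fun x => (U x).1.2) hc),
      Equiv.Perm.sign_swap hij]
  simp

theorem colAntisymmetrizer_mul_single_mul_rowSymmetrizer (T : Numbering m μ) (U : Numbering m ν)
    (g : Equiv.Perm (Fin m)) {i j : Fin m} (hij : i ≠ j) (hr : (T i).1.1 = (T j).1.1)
    (hc : (U (g i)).1.2 = (U (g j)).1.2) :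
    colAntisymmetrizer U * MonoidAlgebra.single g 1 * rowSymmetrizer T = 0 := by
  have h := colAntisymmetrizer_mul_single U (Equiv.swap (g i) (g j))
    (apply_swap_eq (fun x => (U x).1.2) hc)
  rw [Equiv.Perm.sign_swap (g.injective.ne hij)] at h
  apply eq_zero_of_eq_neg_self
  conv_lhs =>
    rw [← single_mul_rowSymmetrizer T (Equiv.swap i j)
      (apply_swap_eq (fun x => (T x).1.1) hr), ← mul_assoc, mul_assoc (colAntisymmetrizer U),
      ← single_mul_single_swap, ← mul_assoc, h]
  simp

/-- To show `a * x * b ∈ W` for all `x` in the group algebra, it suffices to take `x` in the group. -/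
theorem mul_mul_mem_of_single {G : Type*} [Group G] {a b : MonoidAlgebra ℂ G}
    (W : Submodule ℂ (MonoidAlgebra ℂ G))
    (h : ∀ g : G, a * MonoidAlgebra.single g 1 * b ∈ W) (x : MonoidAlgebra ℂ G) :
    a * x * b ∈ W := by
  induction x using MonoidAlgebra.induction_linear with
  | zero => simp
  | add x y hx hy => rw [mul_add, add_mul]; exact W.add_mem hx hy
  | single g r =>
    have : MonoidAlgebra.single g r = r • MonoidAlgebra.single g (1 : ℂ) := by simp
    rw [this, mul_smul_comm, smul_mul_assoc]
    exact W.smul_mem _ (h g)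

end Symmetrizers

/-! ### Combinatorics of two-row numberings and products of Young symmetrizers. -/

section TwoRow

variable {m p : ℕ} {hp : 2 * p ≤ m}

theorem mem_twoRow {x : ℕ × ℕ} :
    x ∈ (twoRow m p hp).cells ↔ (x.1 = 0 ∧ x.2 < m - p) ∨ (x.1 = 1 ∧ x.2 < p) := by
  obtain ⟨a, b⟩ := x
  rw [YoungDiagram.mem_cells, twoRow, YoungDiagram.mem_ofRowLens]
  rcases a with _ | _ | a <;> simp

variable (T : Numbering m (twoRow m p hp))

theorem row_eq_zero_or_one (i : Fin m) : (T i).1.1 = 0 ∨ (T i).1.1 = 1 := by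
  have := mem_twoRow.1 (T i).2
  omega

theorem col_lt_of_row_eq_one {i : Fin m} (h : (T i).1.1 = 1) : (T i).1.2 < p := by
  have := mem_twoRow.1 (T i).2
  omega

theorem col_lt (i : Fin m) : (T i).1.2 < m - p := by
  have := mem_twoRow.1 (T i).2
  omega

theorem exists_row_zero {j : ℕ} (hj : j < m - p) : ∃ i, (T i).1.1 = 0 ∧ (T i).1.2 = j :=
  ⟨T.symm ⟨(0, j), mem_twoRow.2 (by simp [hj])⟩, by simp⟩

theorem exists_row_one {j : ℕ} (hj : j < p) : ∃ i, (T i).1.1 = 1 ∧ (T i).1.2 = j :=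
  ⟨T.symm ⟨(1, j), mem_twoRow.2 (by simp [hj])⟩, by simp⟩

theorem numbering_ext {μ : YoungDiagram} (T : Numbering m μ) {i j : Fin m}
    (h1 : (T i).1.1 = (T j).1.1) (h2 : (T i).1.2 = (T j).1.2) : i = j :=
  T.injective (Subtype.ext (Prod.ext h1 h2))

theorem card_row_one : (Finset.univ.filter fun i => (T i).1.1 = 1).card = p := by
  refine Eq.trans ?_ (Finset.card_range p)
  refine Finset.card_bij (fun i _ => (T i).1.2) ?_ ?_ ?_
  · intro i hi
    simpa using col_lt_of_row_eq_one T (by simpa using hi)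
  · intro i hi j hj h
    simp only [Finset.mem_filter, Finset.mem_univ, true_and] at hi hj
    exact numbering_ext T (hi.trans hj.symm) h
  · intro j hj
    obtain ⟨i, h1, h2⟩ := exists_row_one T (Finset.mem_range.1 hj)
    exact ⟨i, by simpa using h1, h2⟩

/-- If `f` labels the letters by `0` and `1`, distinguishes letters in the same column, and is zero
on the columns of height one, then a column-preserving permutation turns `f` into the row index. -/
theorem exists_col_perm (f : Fin m → ℕ) (hf : ∀ i, f i = 0 ∨ f i = 1)
    (hcol : ∀ i, f i = 1 → (T i).1.2 < p)
    (hinj : ∀ i j, (T i).1.2 = (T j).1.2 → f i = f j → i = j) :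
    ∃ h : Equiv.Perm (Fin m), (∀ i, (T (h i)).1.2 = (T i).1.2) ∧ ∀ i, f (h i) = (T i).1.1 := by
  -- Keeping each letter in its column but using `f` as its row gives a second numbering; the
  -- required permutation compares it with `T`.
  let F : Fin m → (twoRow m p hp).cells := fun i => ⟨(f i, (T i).1.2), mem_twoRow.2 (by
    rcases hf i with h | h
    · exact Or.inl ⟨h, col_lt T i⟩
    · exact Or.inr ⟨h, hcol i h⟩)⟩
  have hF : Function.Injective F := fun i j hij => by
    have := Subtype.ext_iff.1 hij
    simp only [F, Prod.mk.injEq] at this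
    exact hinj i j this.2 this.1
  have hFb : Function.Bijective F :=
    (Fintype.bijective_iff_injective_and_card F).2 ⟨hF, Fintype.card_congr T⟩
  let E := Equiv.ofBijective F hFb
  have key (i : Fin m) : F (E.symm (T i)) = T i := E.apply_symm_apply (T i)
  refine ⟨T.trans E.symm, fun i => ?_, fun i => ?_⟩
  · have := congrArg (fun x => x.1.2) (key i)
    simpa [F] using this
  · have := congrArg (fun x => x.1.1) (key i)
    simpa [F] using this

/-- Pigeonhole: otherwise each of the `q` two-cell columns of `U` would contain a letter that `g`
sends to the second row of `T`, which has only `p < q` cells. -/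
theorem exists_same_col_same_row {q : ℕ} {hq : 2 * q ≤ m} (U : Numbering m (twoRow m q hq))
    (hpq : p < q) (g : Equiv.Perm (Fin m)) :
    ∃ i j, i ≠ j ∧ (U i).1.2 = (U j).1.2 ∧ (T (g i)).1.1 = (T (g j)).1.1 := by
  by_contra! H
  refine absurd hpq (not_lt.2 ?_)
  rw [← card_row_one T, ← Finset.card_range q]
  refine Finset.card_le_card_of_surjOn (fun i => (U (g.symm i)).1.2) ?_
  intro j hj
  have hj : j < q := by simpa using hj
  obtain ⟨u, hu, hu'⟩ := exists_row_zero U (show j < m - q by omega)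
  obtain ⟨v, hv, hv'⟩ := exists_row_one U hj
  have huv : u ≠ v := by rintro rfl; omega
  have hne := H u v huv (hu'.trans hv'.symm)
  have h1 : (T (g u)).1.1 = 1 ∨ (T (g v)).1.1 = 1 := by
    rcases row_eq_zero_or_one T (g u) with h | h <;>
    rcases row_eq_zero_or_one T (g v) with h' | h' <;> omega
  rcases h1 with h | h
  · exact ⟨g u, by simpa using h, by simpa using hu'⟩
  · exact ⟨g v, by simpa using h, by simpa using hv'⟩

theorem exists_col_perm_of_forall_ne (g : Equiv.Perm (Fin m))
    (H : ∀ i j, i ≠ j → (T i).1.2 = (T j).1.2 → (T (g i)).1.1 ≠ (T (g j)).1.1) :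
    ∃ h : Equiv.Perm (Fin m), (∀ i, (T (h i)).1.2 = (T i).1.2) ∧
      ∀ i, (T (g (h i))).1.1 = (T i).1.1 := by
  refine exists_col_perm T (fun i => (T (g i)).1.1) (fun i => row_eq_zero_or_one T _) ?_
    (fun i j h1 h2 => by_contra fun h3 => H i j h3 h1 h2)
  -- Each two-cell column has a letter that `g` sends to the second row. Only `p` letters go there,
  -- so none is left for the one-cell columns.
  have hsub : Finset.range p ⊆
      (Finset.univ.filter fun i => (T i).1.1 = 1).image fun i => (T (g.symm i)).1.2 := by
    intro j hj
    have hj : j < p := by simpa using hj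
    obtain ⟨u, hu, hu'⟩ := exists_row_zero T (show j < m - p by omega)
    obtain ⟨v, hv, hv'⟩ := exists_row_one T hj
    have huv : u ≠ v := by rintro rfl; omega
    have hne := H u v huv (hu'.trans hv'.symm)
    have h1 : (T (g u)).1.1 = 1 ∨ (T (g v)).1.1 = 1 := by
      rcases row_eq_zero_or_one T (g u) with h | h <;>
      rcases row_eq_zero_or_one T (g v) with h' | h' <;> omega
    rw [Finset.mem_image]
    rcases h1 with h | h
    · exact ⟨g u, by simpa using h, by simpa using hu'⟩
    · exact ⟨g v, by simpa using h, by simpa using hv'⟩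
  have heq := Finset.eq_of_subset_of_card_le hsub (by
    rw [Finset.card_range]
    exact Finset.card_image_le.trans (card_row_one T).le)
  intro i hi
  rw [← Finset.mem_range, heq, Finset.mem_image]
  exact ⟨g i, by simpa using hi, by simp⟩

/-- For a group element `g`, either two letters of a column land in one row and the product
vanishes, or `g` is a row permutation times a column permutation and the product is `± c_T`. -/
theorem rowSymmetrizer_mul_mul_colAntisymmetrizer_mem (x : MonoidAlgebra ℂ (Equiv.Perm (Fin m))) :
    rowSymmetrizer T * x * colAntisymmetrizer T ∈ Submodule.span ℂ {youngSymmetrizer T} := by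
  refine mul_mul_mem_of_single _ (fun g => ?_) x
  by_cases H : ∃ i j, i ≠ j ∧ (T i).1.2 = (T j).1.2 ∧ (T (g i)).1.1 = (T (g j)).1.1
  · obtain ⟨i, j, hij, hc, hr⟩ := H
    rw [rowSymmetrizer_mul_single_mul_colAntisymmetrizer T T g hij hc hr]
    exact Submodule.zero_mem _
  · push Not at H
    obtain ⟨h, hh, hg⟩ := exists_col_perm_of_forall_ne T g H
    have e1 : (MonoidAlgebra.single g 1 : MonoidAlgebra ℂ (Equiv.Perm (Fin m))) =
        MonoidAlgebra.single (g * h) 1 * MonoidAlgebra.single h⁻¹ 1 := by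
      simp [MonoidAlgebra.single_mul_single]
    have hh' : ∀ i, (T (h⁻¹ i)).1.2 = (T i).1.2 :=
      apply_inv_eq (f := fun x => (T x).1.2) hh
    rw [e1, ← mul_assoc, rowSymmetrizer_mul_single T (g * h) hg, mul_assoc,
      single_mul_colAntisymmetrizer T _ hh', mul_smul_comm]
    exact Submodule.smul_mem _ _ (Submodule.mem_span_singleton_self _)

theorem youngSymmetrizer_mul_mul_mem (x : MonoidAlgebra ℂ (Equiv.Perm (Fin m))) :
    youngSymmetrizer T * x * youngSymmetrizer T ∈ Submodule.span ℂ {youngSymmetrizer T} := by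
  have := rowSymmetrizer_mul_mul_colAntisymmetrizer_mem T
    (colAntisymmetrizer T * x * rowSymmetrizer T)
  simpa only [youngSymmetrizer, mul_assoc] using this

/-- In `a_T b_T x a_U b_U`, the outer pair `a_T … b_U` forces zero when `p < q`, and the inner pair
`b_T x a_U` is already zero when `q < p`. -/
theorem youngSymmetrizer_mul_mul_eq_zero {q : ℕ} {hq : 2 * q ≤ m}
    (U : Numbering m (twoRow m q hq)) (hpq : p ≠ q) (x : MonoidAlgebra ℂ (Equiv.Perm (Fin m))) :
    youngSymmetrizer T * x * youngSymmetrizer U = 0 := by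
  rcases lt_or_gt_of_ne hpq with h | h
  · have key := mul_mul_mem_of_single (a := rowSymmetrizer T) (b := colAntisymmetrizer U) ⊥
      (fun g => by
        obtain ⟨i, j, hij, hc, hr⟩ := exists_same_col_same_row T U h g
        exact rowSymmetrizer_mul_single_mul_colAntisymmetrizer T U g hij hc hr)
      (colAntisymmetrizer T * x * rowSymmetrizer U)
    simpa only [youngSymmetrizer, mul_assoc, Submodule.mem_bot] using key
  · have key := mul_mul_mem_of_single (a := colAntisymmetrizer T) (b := rowSymmetrizer U) ⊥
      (fun g => by
        obtain ⟨i, j, hij, hc, hr⟩ := exists_same_col_same_row U T h g⁻¹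
        refine colAntisymmetrizer_mul_single_mul_rowSymmetrizer U T g
          (i := g⁻¹ i) (j := g⁻¹ j) (by simpa using hij) hr (by simpa using hc)) x
    rw [Submodule.mem_bot] at key
    calc _ = rowSymmetrizer T * (colAntisymmetrizer T * x * rowSymmetrizer U) *
          colAntisymmetrizer U := by simp only [youngSymmetrizer, mul_assoc]
      _ = 0 := by rw [key]; simp

end TwoRow

/-! ### Semisimple rings. -/

section Semisimple

/-- The left ideal of `w` is generated by an idempotent `e = y w`, and `e = e e = y (w y w) = 0`. -/
theorem eq_zero_of_forall_mul_mul_self {R : Type*} [Ring R] [IsSemisimpleRing R] {w : R}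
    (h : ∀ y, w * y * w = 0) : w = 0 := by
  obtain ⟨e, he, hw⟩ := IsSemisimpleRing.ideal_eq_span_idempotent (Ideal.span {w})
  have h1 : e ∈ Ideal.span {w} := hw ▸ Ideal.mem_span_singleton_self e
  have h2 : w ∈ Ideal.span {e} := hw ▸ Ideal.mem_span_singleton_self w
  obtain ⟨y, rfl⟩ := Ideal.mem_span_singleton'.1 h1
  obtain ⟨z, hz⟩ := Ideal.mem_span_singleton'.1 h2
  have h3 : y * w = 0 := by
    rw [← he.eq, mul_assoc, ← mul_assoc w, h, mul_zero]
  rw [← hz, h3, mul_zero]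

end Semisimple

/-! ### Recovering the Young symmetrizer from any nonzero element of its left ideal. -/

section Specht

variable {m p : ℕ} {hp : 2 * p ≤ m} (T : Numbering m (twoRow m p hp))

theorem mem_spechtModule {μ : YoungDiagram} {T : Numbering m μ}
    {w : MonoidAlgebra ℂ (Equiv.Perm (Fin m))} :
    w ∈ (spechtModule T).toSubmodule ↔ ∃ x, x * youngSymmetrizer T = w := Iff.rfl

theorem youngSymmetrizer_mem {μ : YoungDiagram} (T : Numbering m μ) :
    youngSymmetrizer T ∈ (spechtModule T).toSubmodule :=
  mem_spechtModule.2 ⟨1, one_mul _⟩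

/-- Write `w = x c`. Each `c y x c` is a multiple of `c`; if all were zero, then `w y w = x (c y x
c) = 0` for every `y`, forcing `w = 0`. Otherwise rescale `y`. -/
theorem exists_youngSymmetrizer_mul_mul_eq {w : MonoidAlgebra ℂ (Equiv.Perm (Fin m))}
    (hw : w ∈ (spechtModule T).toSubmodule) (hw0 : w ≠ 0) :
    ∃ y, youngSymmetrizer T * y * w = youngSymmetrizer T := by
  obtain ⟨x, rfl⟩ := mem_spechtModule.1 hw
  by_contra! H
  refine hw0 (eq_zero_of_forall_mul_mul_self fun y => ?_)
  have h1 : youngSymmetrizer T * (y * x) * youngSymmetrizer T = 0 := by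
    obtain ⟨r, hr⟩ := Submodule.mem_span_singleton.1 (youngSymmetrizer_mul_mul_mem T (y * x))
    by_contra h
    have hr0 : r ≠ 0 := by
      rintro rfl
      exact h (by rw [← hr, zero_smul])
    refine H (r⁻¹ • y) ?_
    rw [mul_smul_comm, smul_mul_assoc]
    simp only [mul_assoc] at hr ⊢
    rw [← hr, smul_smul, inv_mul_cancel₀ hr0, one_smul]
  calc _ = x * (youngSymmetrizer T * (y * x) * youngSymmetrizer T) := by simp only [mul_assoc]
    _ = 0 := by rw [h1, mul_zero]

end Specht

/-! ### Permutations matching two labellings with equal fibre sizes. -/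

section FiberPerm

theorem exists_perm_comp_eq {α β : Type*} [Fintype α] [DecidableEq β] (f g : α → β)
    (h : ∀ b, (Finset.univ.filter fun a => f a = b).card = (Finset.univ.filter fun a => g a = b).card) :
    ∃ σ : Equiv.Perm α, ∀ a, g (σ a) = f a := by
  have e (b : β) : Nonempty ({a // f a = b} ≃ {a // g a = b}) :=
    Fintype.card_eq.1 (by rw [Fintype.card_subtype, Fintype.card_subtype, h b])
  let e (b : β) := (e b).some
  refine ⟨(Equiv.sigmaFiberEquiv f).symm.trans
    ((Equiv.sigmaCongrRight e).trans (Equiv.sigmaFiberEquiv g)), fun a => ?_⟩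
  exact (e (f a) ⟨a, rfl⟩).2

end FiberPerm

/-! ### Coefficients of square-free polynomials and the group algebra action. -/

section SquareFree

variable {m k : ℕ}

theorem permVars_sqFreeMonomial (σ : Equiv.Perm (Fin m)) (s : Finset (Fin m)) :
    permVars m σ (sqFreeMonomial s) = sqFreeMonomial (s.map σ.toEmbedding) := by
  simp [permVars, sqFreeMonomial, map_prod]

/-- Evaluation at the indicator vector of `s`. -/
noncomputable def evalInd (s : Finset (Fin m)) : MvPolynomial (Fin m) ℂ →ₗ[ℂ] ℂ :=
  (aeval fun i => if i ∈ s then (1 : ℂ) else 0).toLinearMap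

theorem evalInd_sqFreeMonomial (s t : Finset (Fin m)) :
    evalInd s (sqFreeMonomial t) = if t ⊆ s then 1 else 0 := by
  simp only [evalInd, sqFreeMonomial, AlgHom.toLinearMap_apply, map_prod, aeval_X]
  rw [Finset.prod_ite_zero]
  simp [Finset.subset_iff]

theorem evalInd_permVars (s : Finset (Fin m)) (σ : Equiv.Perm (Fin m))
    (f : MvPolynomial (Fin m) ℂ) :
    evalInd (s.map σ.toEmbedding) (permVars m σ f) = evalInd s f := by
  simp only [evalInd, permVars, AlgHom.toLinearMap_apply, MonoidHom.coe_mk, OneHom.coe_mk,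
    aeval_rename]
  congr 2
  funext i
  simp

theorem sqFreeMonomial_mem_SF {s : Finset (Fin m)} (hs : s.card = k) :
    sqFreeMonomial s ∈ (SF m k).toSubmodule :=
  Submodule.subset_span ⟨s, hs, rfl⟩

/-- Between sets of the same size `k`, inclusion is equality, so evaluation at the indicator of `s`
reads off the coefficient of the monomial of `s`. -/
theorem eq_sum_evalInd_smul {f : MvPolynomial (Fin m) ℂ} (hf : f ∈ (SF m k).toSubmodule) :
    f = ∑ s ∈ Finset.powersetCard k Finset.univ, evalInd s f • sqFreeMonomial s := by
  refine Submodule.span_induction ?_ ?_ ?_ ?_ hf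
  · rintro _ ⟨t, ht, rfl⟩
    rw [Finset.sum_eq_single t]
    · simp [evalInd_sqFreeMonomial]
    · intro s hs hst
      rw [Finset.mem_powersetCard] at hs
      rw [evalInd_sqFreeMonomial, if_neg, zero_smul]
      intro h
      exact hst (Finset.eq_of_subset_of_card_le h (by rw [hs.2, ht])).symm
    · intro h
      exact absurd (Finset.mem_powersetCard.2 ⟨Finset.subset_univ _, ht⟩) h
  · simp
  · intro x y _ _ hx hy
    simp only [map_add, add_smul, Finset.sum_add_distrib]
    rw [← hx, ← hy]
  · intro a x _ hx
    simp only [map_smul, smul_eq_mul, mul_smul, ← Finset.smul_sum]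
    rw [← hx]

theorem eq_zero_of_evalInd_eq_zero {f : MvPolynomial (Fin m) ℂ} (hf : f ∈ (SF m k).toSubmodule)
    (h : ∀ s : Finset (Fin m), s.card = k → evalInd s f = 0) : f = 0 := by
  rw [eq_sum_evalInd_smul hf]
  refine Finset.sum_eq_zero fun s hs => ?_
  rw [h s (Finset.mem_powersetCard.1 hs).2, zero_smul]

/-- The group algebra acting on polynomials by permutation of the variables. -/
noncomputable abbrev algAct (m : ℕ) :
    MonoidAlgebra ℂ (Equiv.Perm (Fin m)) →ₐ[ℂ] Module.End ℂ (MvPolynomial (Fin m) ℂ) :=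
  (permVars m).asAlgebraHom

theorem algAct_mem (x : MonoidAlgebra ℂ (Equiv.Perm (Fin m)))
    (N : Submodule ℂ (MvPolynomial (Fin m) ℂ))
    (hN : ∀ g, ∀ f ∈ N, permVars m g f ∈ N)
    {f : MvPolynomial (Fin m) ℂ} (hf : f ∈ N) : algAct m x f ∈ N := by
  induction x using MonoidAlgebra.induction_linear with
  | zero => simp
  | add x y hx hy => rw [map_add]; exact N.add_mem hx hy
  | single g r =>
    rw [Representation.asAlgebraHom_single]
    exact N.smul_mem _ (hN g f hf)

theorem algAct_mem_SF (x : MonoidAlgebra ℂ (Equiv.Perm (Fin m)))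
    {f : MvPolynomial (Fin m) ℂ} (hf : f ∈ (SF m k).toSubmodule) :
    algAct m x f ∈ (SF m k).toSubmodule :=
  algAct_mem x _ (fun g _ h => (SF m k).apply_mem_toSubmodule g h) hf

theorem algAct_mul_apply (x y : MonoidAlgebra ℂ (Equiv.Perm (Fin m)))
    (f : MvPolynomial (Fin m) ℂ) : algAct m (x * y) f = algAct m x (algAct m y f) := by
  rw [map_mul, Module.End.mul_apply]

theorem algAct_single_one (g : Equiv.Perm (Fin m)) (f : MvPolynomial (Fin m) ℂ) :
    algAct m (MonoidAlgebra.single g 1) f = permVars m g f := by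
  rw [Representation.asAlgebraHom_single_one]

end SquareFree

/-! ### Young symmetrizers acting on square-free monomials. -/

section TwoRow

variable {m p : ℕ} {hp : 2 * p ≤ m} (T : Numbering m (twoRow m p hp)) (k : ℕ)

/-- The letters in the first `k` cells of the first row. -/
def topCells : Finset (Fin m) :=
  Finset.univ.filter fun i => (T i).1.1 = 0 ∧ (T i).1.2 < k

variable {k}

theorem mem_topCells {i : Fin m} : i ∈ topCells T k ↔ (T i).1.1 = 0 ∧ (T i).1.2 < k := by
  simp [topCells]

theorem card_topCells (hk : k ≤ m - p) : (topCells T k).card = k := by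
  refine Eq.trans ?_ (Finset.card_range k)
  refine Finset.card_bij (fun i _ => (T i).1.2) ?_ ?_ ?_
  · intro i hi
    simpa using ((mem_topCells T).1 hi).2
  · intro i hi j hj h
    exact numbering_ext T (((mem_topCells T).1 hi).1.trans ((mem_topCells T).1 hj).1.symm) h
  · intro j hj
    have hj : j < k := by simpa using hj
    obtain ⟨i, h1, h2⟩ := exists_row_zero T (show j < m - p by omega)
    exact ⟨i, (mem_topCells T).2 ⟨h1, h2 ▸ hj⟩, h2⟩

theorem row_eq_zero_of_le_col {i : Fin m} (hi : p ≤ (T i).1.2) : (T i).1.1 = 0 := by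
  rcases row_eq_zero_or_one T i with h | h
  · exact h
  · have := col_lt_of_row_eq_one T h
    omega

theorem eq_of_col_eq_of_le_col {i j : Fin m} (h : (T i).1.2 = (T j).1.2) (hi : p ≤ (T j).1.2) :
    i = j :=
  numbering_ext T ((row_eq_zero_of_le_col T (h ▸ hi)).trans (row_eq_zero_of_le_col T hi).symm) h

theorem card_filter_not_and_mem_eq {α : Type*} [Fintype α] [DecidableEq α] {P : α → Prop} [DecidablePred P]
    {s t : Finset α} (hst : s.card = t.card) (h : ∀ a, P a → (a ∈ s ↔ a ∈ t)) :
    (Finset.univ.filter fun a => ¬ P a ∧ a ∈ s).card =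
      (Finset.univ.filter fun a => ¬ P a ∧ a ∈ t).card := by
  have h1 := Finset.card_filter_add_card_filter_not (s := s) P
  have h2 := Finset.card_filter_add_card_filter_not (s := t) P
  have h3 : s.filter P = t.filter P := by
    ext a
    simp only [Finset.mem_filter]
    exact ⟨fun H => ⟨(h a H.2).1 H.1, H.2⟩, fun H => ⟨(h a H.2).2 H.1, H.2⟩⟩
  have h4 (u : Finset α) : (Finset.univ.filter fun a => ¬ P a ∧ a ∈ u) = u.filter fun a => ¬ P a := by
    ext a
    simp [and_comm]
  rw [h4, h4]
  rw [h3] at h1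
  omega

theorem exists_perm_map_eq_of_agree {α : Type*} [Fintype α] [DecidableEq α] {P : α → Prop}
    [DecidablePred P] {s t : Finset α} (hst : s.card = t.card) (h : ∀ a, P a → (a ∈ s ↔ a ∈ t)) :
    ∃ τ : Equiv.Perm α, (∀ a, P a → τ a = a) ∧ s.map τ.toEmbedding = t := by
  -- The label `some a` on points of `P` makes them singleton fibres, so the permutation must fix
  -- them; the second label carries `s` to `t`.
  obtain ⟨τ, hτ⟩ := exists_perm_comp_eq
    (fun a => (if P a then some a else none, decide (a ∈ s)))
    (fun a => (if P a then some a else none, decide (a ∈ t))) (by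
      rintro ⟨_ | a, b⟩
      · have h0 (u : Finset α) (b : Bool) (a : α) :
          (((if P a then some a else none, decide (a ∈ u)) : Option α × Bool) = (none, b)) ↔
            ¬ P a ∧ (decide (a ∈ u) = b) := by
          by_cases hP : P a <;> simp [hP]
        simp only [h0]
        cases b
        · have hc : sᶜ.card = tᶜ.card := by rw [Finset.card_compl, Finset.card_compl, hst]
          have := card_filter_not_and_mem_eq (P := P) hc (fun a ha => by
            rw [Finset.mem_compl, Finset.mem_compl, h a ha])
          simpa using this
        · simpa using card_filter_not_and_mem_eq (P := P) hst h
      · congr 1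
        ext x
        by_cases hP : P x
        · simp [hP, h x hP]
        · simp [hP])
  refine ⟨τ, fun a ha => ?_, ?_⟩
  · have := congrArg Prod.fst (hτ a)
    simp only [ha, if_true] at this
    split_ifs at this with h1
    exact Option.some.inj this
  · refine Finset.eq_of_subset_of_card_le ?_ (by rw [Finset.card_map, hst])
    intro x hx
    obtain ⟨a, ha, rfl⟩ := Finset.mem_map.1 hx
    have := congrArg Prod.snd (hτ a)
    simpa [ha] using this

/-- By `H`, `s` contains exactly one letter of each two-cell column. Column flips `h` match these
with the first row; the remaining letters lie in one-cell columns, where `τ` rearranges them. -/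
theorem exists_straightening (hpk : p ≤ k) (hk : k ≤ m - p) {s : Finset (Fin m)}
    (hs : s.card = k)
    (H : ∀ i j, i ≠ j → (T i).1.2 = (T j).1.2 → ¬ (i ∈ s ↔ j ∈ s)) :
    ∃ h τ : Equiv.Perm (Fin m), (∀ i, (T (h i)).1.2 = (T i).1.2) ∧
      (∀ i, (T i).1.2 < p → τ i = i) ∧ s = (topCells T k).map (h * τ).toEmbedding := by
  obtain ⟨h, hh, hr⟩ := exists_col_perm T
    (fun i => if (T i).1.2 < p ∧ i ∉ s then 1 else 0)
    (fun i => by split_ifs <;> simp)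
    (fun i hi => by
      by_contra h
      simp [h] at hi)
    (fun i j hc hf => by
      by_contra hij
      by_cases hi : p ≤ (T j).1.2
      · exact hij (eq_of_col_eq_of_le_col T hc hi)
      · refine H i j hij hc ?_
        simp only [hc, not_le.1 hi, true_and] at hf
        by_cases h1 : i ∈ s <;> by_cases h2 : j ∈ s <;> simp_all)
  obtain ⟨τ, hτ, hmap⟩ := exists_perm_map_eq_of_agree (P := fun i => (T i).1.2 < p)
    (s := topCells T k) (t := s.map h⁻¹.toEmbedding)
    (by rw [card_topCells T hk, Finset.card_map, hs]) (fun i hi => by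
      have h1 := hr i
      have h2 : i ∈ s.map h⁻¹.toEmbedding ↔ h i ∈ s := by
        constructor
        · intro hx
          obtain ⟨a, ha, rfl⟩ := Finset.mem_map.1 hx
          simpa using ha
        · intro hx
          exact Finset.mem_map.2 ⟨h i, hx, by simp⟩
      rw [h2, mem_topCells]
      simp only [hh, hi, true_and] at h1
      have h3 : (T i).1.2 < k := by omega
      by_cases h4 : h i ∈ s <;> simp [h4] at h1 <;> simp [h4, ← h1, h3])
  refine ⟨h, τ, hh, hτ, ?_⟩
  ext i
  have hmem : i ∈ s ↔ h⁻¹ i ∈ s.map h⁻¹.toEmbedding := (Finset.mem_map' _).symm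
  rw [hmem, ← hmap]
  simp only [Finset.mem_map, Equiv.coe_toEmbedding, Equiv.Perm.mul_apply]
  refine exists_congr fun a => and_congr_right fun _ => ?_
  rw [Equiv.Perm.eq_inv_iff_eq]

/-- Column-preserving permutations move only letters of the first `p` columns, so their supports are
disjoint from that of `τ`. -/
theorem colAntisymmetrizer_mul_single_comm {τ : Equiv.Perm (Fin m)}
    (hτ : ∀ i, (T i).1.2 < p → τ i = i) :
    colAntisymmetrizer T * MonoidAlgebra.single τ 1 =
      MonoidAlgebra.single τ 1 * colAntisymmetrizer T := by
  simp only [colAntisymmetrizer, Finset.mul_sum, Finset.sum_mul, MonoidAlgebra.single_mul_single,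
    one_mul, mul_one]
  refine Finset.sum_congr rfl fun g hg => ?_
  have hg : ∀ i, (T (g i)).1.2 = (T i).1.2 := by simpa using hg
  congr 1
  refine Equiv.ext fun i => ?_
  rw [Equiv.Perm.mul_apply, Equiv.Perm.mul_apply]
  by_cases hi : (T i).1.2 < p
  · rw [hτ i hi, hτ (g i) (by rwa [hg])]
  · have h1 : p ≤ (T (τ i)).1.2 := by
      by_contra h
      have := τ.injective (hτ (τ i) (not_le.1 h))
      rw [this] at h
      omega
    rw [eq_of_col_eq_of_le_col T (hg i) (not_lt.1 hi), eq_of_col_eq_of_le_col T (hg (τ i)) h1]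

theorem row_apply_eq {τ : Equiv.Perm (Fin m)} (hτ : ∀ i, (T i).1.2 < p → τ i = i) (i : Fin m) :
    (T (τ i)).1.1 = (T i).1.1 := by
  by_cases hi : (T i).1.2 < p
  · rw [hτ i hi]
  · have h1 : p ≤ (T (τ i)).1.2 := by
      by_contra h
      have := τ.injective (hτ (τ i) (not_le.1 h))
      rw [this] at h
      omega
    rw [row_eq_zero_of_le_col T h1, row_eq_zero_of_le_col T (not_lt.1 hi)]

theorem colAntisymmetrizer_apply_eq_zero {μ : YoungDiagram} (T : Numbering m μ)
    {s : Finset (Fin m)} {i j : Fin m} (hij : i ≠ j)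
    (hc : (T i).1.2 = (T j).1.2) (hs : i ∈ s ↔ j ∈ s) :
    algAct m (colAntisymmetrizer T) (sqFreeMonomial s) = 0 := by
  have h1 := colAntisymmetrizer_mul_single T (Equiv.swap i j)
    (apply_swap_eq (fun x => (T x).1.2) hc)
  rw [Equiv.Perm.sign_swap hij] at h1
  have h2 : s.map (Equiv.swap i j).toEmbedding = s := by
    refine Finset.eq_of_subset_of_card_le ?_ (by rw [Finset.card_map])
    intro x hx
    obtain ⟨a, ha, rfl⟩ := Finset.mem_map.1 hx
    have := apply_swap_eq (fun x => x ∈ s) (propext hs) a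
    exact this.symm ▸ ha
  apply eq_zero_of_eq_neg_self
  conv_lhs => rw [← h2, ← permVars_sqFreeMonomial, ← algAct_single_one, ← algAct_mul_apply, h1]
  simp

/-- If a column has two letters both inside or both outside `s`, the antisymmetrizer kills the
monomial. Otherwise straightening applies, and `c h τ = sgn(h) a b τ = sgn(h) a τ b = sgn(h) c`. -/
theorem youngSymmetrizer_apply_sqFreeMonomial (hpk : p ≤ k) (hk : k ≤ m - p) {s : Finset (Fin m)}
    (hs : s.card = k) :
    algAct m (youngSymmetrizer T) (sqFreeMonomial s) ∈
      Submodule.span ℂ {algAct m (youngSymmetrizer T) (sqFreeMonomial (topCells T k))} := by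
  by_cases H : ∃ i j, i ≠ j ∧ (T i).1.2 = (T j).1.2 ∧ (i ∈ s ↔ j ∈ s)
  · obtain ⟨i, j, hij, hc, h⟩ := H
    have h0 : algAct m (youngSymmetrizer T) (sqFreeMonomial s) = 0 := by
      rw [youngSymmetrizer, algAct_mul_apply, colAntisymmetrizer_apply_eq_zero T hij hc h, map_zero]
    exact h0 ▸ Submodule.zero_mem _
  · push Not at H
    obtain ⟨h, τ, hh, hτ, rfl⟩ := exists_straightening T hpk hk hs (fun i j h1 h2 h3 => by
      have := H i j h1 h2
      tauto)
    have e : youngSymmetrizer T * (MonoidAlgebra.single h 1 * MonoidAlgebra.single τ 1) =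
        ((Equiv.Perm.sign h : ℤ) : ℂ) • youngSymmetrizer T := by
      rw [youngSymmetrizer, mul_assoc, ← mul_assoc (colAntisymmetrizer T),
        colAntisymmetrizer_mul_single T h hh, smul_mul_assoc, mul_smul_comm,
        colAntisymmetrizer_mul_single_comm T hτ, ← mul_assoc,
        rowSymmetrizer_mul_single T τ (row_apply_eq T hτ)]
    rw [← permVars_sqFreeMonomial, ← algAct_single_one, ← algAct_mul_apply,
      ← mul_one (1 : ℂ), ← MonoidAlgebra.single_mul_single, e, map_smul, LinearMap.smul_apply]
    exact Submodule.smul_mem _ _ (Submodule.mem_span_singleton_self _)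

theorem youngSymmetrizer_apply_mem_span (hpk : p ≤ k) (hk : k ≤ m - p)
    {f : MvPolynomial (Fin m) ℂ} (hf : f ∈ (SF m k).toSubmodule) :
    algAct m (youngSymmetrizer T) f ∈
      Submodule.span ℂ {algAct m (youngSymmetrizer T) (sqFreeMonomial (topCells T k))} := by
  have : (SF m k).toSubmodule ≤ (Submodule.span ℂ
      {algAct m (youngSymmetrizer T) (sqFreeMonomial (topCells T k))}).comap
        (algAct m (youngSymmetrizer T)) := by
    refine Submodule.span_le.2 ?_
    rintro _ ⟨s, hs, rfl⟩
    exact youngSymmetrizer_apply_sqFreeMonomial T hpk hk hs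
  exact this hf

theorem eq_one_of_map_topCells_subset (hpk : p ≤ k) {h : Equiv.Perm (Fin m)}
    (hh : ∀ i, (T (h i)).1.2 = (T i).1.2)
    (hs : (topCells T k).map h.toEmbedding ⊆ Finset.univ.filter fun i => (T i).1.1 = 0) :
    h = 1 := by
  have h0 (i : Fin m) (hi : (T i).1.1 = 0) : h i = i := by
    by_cases hc : (T i).1.2 < p
    · have := hs (Finset.mem_map_of_mem _ ((mem_topCells T).2 ⟨hi, by omega⟩))
      exact numbering_ext T ((by simpa using this : (T (h i)).1.1 = 0).trans hi.symm) (hh i)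
    · exact eq_of_col_eq_of_le_col T (hh i) (not_lt.1 hc)
  refine Equiv.ext fun i => ?_
  rw [Equiv.Perm.one_apply]
  rcases row_eq_zero_or_one T i with hi | hi
  · exact h0 i hi
  · rcases row_eq_zero_or_one T (h i) with h1 | h1
    · exact h.injective (h0 (h i) h1)
    · exact numbering_ext T (h1.trans hi.symm) (hh i)

/-- Evaluate at the indicator of the first row `D`. Row permutations fix `D`, so `a` only multiplies
the value by their number; in `b`, only the identity keeps the monomial inside `D`, because `p ≤ k`.
-/
theorem youngSymmetrizer_apply_topCells_ne_zero (hpk : p ≤ k) :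
    algAct m (youngSymmetrizer T) (sqFreeMonomial (topCells T k)) ≠ 0 := by
  set D : Finset (Fin m) := Finset.univ.filter fun i => (T i).1.1 = 0 with hD
  have hb : evalInd D (algAct m (colAntisymmetrizer T) (sqFreeMonomial (topCells T k))) = 1 := by
    simp only [colAntisymmetrizer, map_sum, LinearMap.sum_apply,
      Representation.asAlgebraHom_single, LinearMap.smul_apply, map_smul,
      permVars_sqFreeMonomial, evalInd_sqFreeMonomial]
    rw [Finset.sum_eq_single 1]
    · rw [if_pos]
      · simp
      · intro x hx
        obtain ⟨a, ha, rfl⟩ := Finset.mem_map.1 hx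
        simpa [hD] using ((mem_topCells T).1 ha).1
    · intro h hh h1
      rw [if_neg, smul_zero]
      exact fun H => h1 (eq_one_of_map_topCells_subset T hpk (by simpa using hh) H)
    · intro h
      simp at h
  have ha (f : MvPolynomial (Fin m) ℂ) : evalInd D (algAct m (rowSymmetrizer T) f) =
      ((Finset.univ.filter fun g : Equiv.Perm (Fin m) =>
        ∀ i, (T (g i)).1.1 = (T i).1.1).card : ℂ) * evalInd D f := by
    simp only [rowSymmetrizer, map_sum, LinearMap.sum_apply,
      Representation.asAlgebraHom_single, one_smul]
    rw [Finset.sum_congr rfl (g := fun _ => evalInd D f), Finset.sum_const, nsmul_eq_mul]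
    intro g hg
    have hg : ∀ i, (T (g i)).1.1 = (T i).1.1 := by simpa using hg
    have hgD : D.map g.toEmbedding = D := by
      refine Finset.eq_of_subset_of_card_le ?_ (by rw [Finset.card_map])
      intro x hx
      obtain ⟨a, ha, rfl⟩ := Finset.mem_map.1 hx
      simpa [hD, hg] using ha
    conv_lhs => rw [← hgD, evalInd_permVars]
  intro h0
  have h1 := ha (algAct m (colAntisymmetrizer T) (sqFreeMonomial (topCells T k)))
  rw [← algAct_mul_apply, ← youngSymmetrizer, h0, map_zero, hb, mul_one, eq_comm,
    Nat.cast_eq_zero, Finset.card_eq_zero] at h1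
  have : (1 : Equiv.Perm (Fin m)) ∈ (∅ : Finset (Equiv.Perm (Fin m))) := by
    rw [← h1]
    simp
  simp at this

end TwoRow

/-! ### Invariants of the stabilizer of a `k`-set. -/

section Stabilizer

variable {m k : ℕ}

theorem exists_perm_map_eq_pair {α : Type*} [Fintype α] [DecidableEq α] {s t u : Finset α}
    (hst : s.card = t.card) (h : (s ∩ u).card = (t ∩ u).card) :
    ∃ σ : Equiv.Perm α, u.map σ.toEmbedding = u ∧ s.map σ.toEmbedding = t := by
  obtain ⟨σ, hσ⟩ := exists_perm_comp_eq
    (fun a => (decide (a ∈ s), decide (a ∈ u))) (fun a => (decide (a ∈ t), decide (a ∈ u))) (by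
      have h1 (v : Finset α) : (Finset.univ.filter fun a => a ∈ v ∧ a ∈ u) = v ∩ u := by
        ext; simp
      have h2 (v : Finset α) : (Finset.univ.filter fun a => a ∈ v ∧ a ∉ u) = v \ u := by
        ext; simp
      have h3 (v : Finset α) : (Finset.univ.filter fun a => a ∉ v ∧ a ∈ u) = u \ v := by
        ext; simp [and_comm]
      have h4 (v : Finset α) : (Finset.univ.filter fun a => a ∉ v ∧ a ∉ u) = (v ∪ u)ᶜ := by
        ext; simp
      have e1 := Finset.card_inter_add_card_sdiff s u
      have e2 := Finset.card_inter_add_card_sdiff t u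
      have e3 := Finset.card_inter_add_card_sdiff u s
      have e4 := Finset.card_inter_add_card_sdiff u t
      have e5 := Finset.card_union_add_card_inter s u
      have e6 := Finset.card_union_add_card_inter t u
      rw [Finset.inter_comm] at e3 e4
      rintro ⟨_ | _, _ | _⟩ <;>
        simp only [Prod.mk.injEq, decide_eq_true_eq, decide_eq_false_iff_not]
      · rw [h4, h4, Finset.card_compl, Finset.card_compl]; omega
      · rw [h3, h3]; omega
      · rw [h2, h2]; omega
      · rw [h1, h1]; omega)
  refine ⟨σ, ?_, ?_⟩
  · refine Finset.eq_of_subset_of_card_le ?_ (by rw [Finset.card_map])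
    intro x hx
    obtain ⟨a, ha, rfl⟩ := Finset.mem_map.1 hx
    have := congrArg Prod.snd (hσ a)
    simpa [ha] using this
  · refine Finset.eq_of_subset_of_card_le ?_ (by rw [Finset.card_map, hst])
    intro x hx
    obtain ⟨a, ha, rfl⟩ := Finset.mem_map.1 hx
    have := congrArg Prod.fst (hσ a)
    simpa [ha] using this

/-- The elements of `SF m k` which are fixed by the stabilizer of the set `u`. -/
def invariantsSF (k : ℕ) (u : Finset (Fin m)) : Submodule ℂ (MvPolynomial (Fin m) ℂ) where
  carrier := {f | f ∈ (SF m k).toSubmodule ∧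
    ∀ h : Equiv.Perm (Fin m), u.map h.toEmbedding = u → permVars m h f = f}
  zero_mem' := ⟨Submodule.zero_mem _, fun _ _ => map_zero _⟩
  add_mem' hf hg := ⟨Submodule.add_mem _ hf.1 hg.1, fun h hh => by
    rw [map_add, hf.2 h hh, hg.2 h hh]⟩
  smul_mem' c f hf := ⟨Submodule.smul_mem _ c hf.1, fun h hh => by
    rw [map_smul, hf.2 h hh]⟩

/-- The sums of the coefficients of a square-free polynomial over the `k`-subsets meeting `u` in
`j` elements. -/
noncomputable def orbitSums (k : ℕ) (u : Finset (Fin m)) :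
    MvPolynomial (Fin m) ℂ →ₗ[ℂ] (Fin (k + 1) → ℂ) :=
  LinearMap.pi fun j => ∑ s ∈ Finset.powersetCard k Finset.univ with (s ∩ u).card = j, evalInd s

/-- The coefficients of an invariant are constant on each orbit, so an orbit sum is a positive
integer times the common coefficient. -/
theorem eq_zero_of_orbitSums_eq_zero {u : Finset (Fin m)} {f : MvPolynomial (Fin m) ℂ}
    (hf : f ∈ invariantsSF k u) (h : orbitSums k u f = 0) : f = 0 := by
  refine eq_zero_of_evalInd_eq_zero hf.1 fun s hs => ?_
  have hlt : (s ∩ u).card < k + 1 :=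
    Nat.lt_succ_of_le (hs ▸ Finset.card_le_card Finset.inter_subset_left)
  have h1 := congrFun h ⟨_, hlt⟩
  simp only [orbitSums, LinearMap.pi_apply, LinearMap.sum_apply, Pi.zero_apply] at h1
  rw [Finset.sum_congr rfl (g := fun _ => evalInd s f), Finset.sum_const, nsmul_eq_mul,
    mul_eq_zero, Nat.cast_eq_zero, Finset.card_eq_zero] at h1
  · refine h1.resolve_left fun h2 => ?_
    have : s ∈ (∅ : Finset (Finset (Fin m))) := by
      rw [← h2]
      simp [hs]
    simp at this
  · intro t ht
    simp only [Finset.mem_filter, Finset.mem_powersetCard, Finset.subset_univ, true_and] at ht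
    obtain ⟨σ, hu, rfl⟩ := exists_perm_map_eq_pair (hs.trans ht.1.symm) ht.2.symm
    conv_lhs => rw [← hf.2 σ hu]
    exact evalInd_permVars s σ f

theorem finrank_invariantsSF_le (u : Finset (Fin m)) :
    Module.Finite ℂ (invariantsSF k u) ∧ Module.finrank ℂ (invariantsSF k u) ≤ k + 1 := by
  have hinj : Function.Injective ((orbitSums k u).comp (invariantsSF k u).subtype) := by
    rw [← LinearMap.ker_eq_bot, LinearMap.ker_eq_bot']
    exact fun f hf => Subtype.ext (eq_zero_of_orbitSums_eq_zero f.2 hf)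
  refine ⟨Module.Finite.of_injective _ hinj, ?_⟩
  simpa using LinearMap.finrank_le_finrank_of_injective hinj

/-- A nonzero element of `SF m k` can be moved by the group algebra to a nonzero polynomial which is
invariant under the stabilizer of a given `k`-subset. -/
theorem exists_algAct_mem_invariantsSF {u : Finset (Fin m)} (hu : u.card = k)
    {f : MvPolynomial (Fin m) ℂ} (hf : f ∈ (SF m k).toSubmodule) (hf0 : f ≠ 0) :
    ∃ x, algAct m x f ∈ invariantsSF k u ∧ algAct m x f ≠ 0 := by
  obtain ⟨s, hs, hsf⟩ : ∃ s : Finset (Fin m), s.card = k ∧ evalInd s f ≠ 0 := by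
    by_contra! H
    exact hf0 (eq_zero_of_evalInd_eq_zero hf H)
  -- Move a set with nonzero coefficient onto `u`, then sum over the stabilizer of `u`: the
  -- coefficient at `u` is only multiplied by the order of the stabilizer.
  obtain ⟨g, -, rfl⟩ := exists_perm_map_eq_pair (u := ∅) (hs.trans hu.symm) (by simp)
  set u := s.map g.toEmbedding with hu'
  let H : Finset (Equiv.Perm (Fin m)) := Finset.univ.filter fun h => u.map h.toEmbedding = u
  let y : MonoidAlgebra ℂ (Equiv.Perm (Fin m)) := ∑ h ∈ H, MonoidAlgebra.single h 1
  have hy (t : Equiv.Perm (Fin m)) (ht : u.map t.toEmbedding = u) :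
      MonoidAlgebra.single t 1 * y = y := by
    simp only [y, Finset.mul_sum, MonoidAlgebra.single_mul_single, mul_one]
    refine Finset.sum_equiv (Equiv.mulLeft t) (fun h => ?_) (fun h _ => by simp)
    have e : u.map (t * h).toEmbedding = (u.map h.toEmbedding).map t.toEmbedding := by
      have e' : (t * h).toEmbedding = h.toEmbedding.trans t.toEmbedding :=
        Function.Embedding.ext fun i => Equiv.Perm.mul_apply t h i
      rw [e', ← Finset.map_map]
    simp only [H, Finset.mem_filter, Finset.mem_univ, true_and, Equiv.coe_mulLeft, e]
    refine ⟨fun hh => by rw [hh, ht], fun hh => ?_⟩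
    exact Finset.map_injective t.toEmbedding (hh.trans ht.symm)
  refine ⟨y * MonoidAlgebra.single g 1, ⟨algAct_mem_SF _ hf, fun t ht => ?_⟩, fun h0 => ?_⟩
  · rw [← algAct_single_one, ← algAct_mul_apply, ← mul_assoc, hy t ht]
  · have h1 : evalInd u (algAct m (y * MonoidAlgebra.single g 1) f) = H.card * evalInd s f := by
      rw [algAct_mul_apply, algAct_single_one]
      simp only [y, map_sum, LinearMap.sum_apply, Representation.asAlgebraHom_single, one_smul]
      rw [Finset.sum_congr rfl (g := fun _ => evalInd s f), Finset.sum_const, nsmul_eq_mul]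
      intro h hh
      have hh : u.map h.toEmbedding = u := by simpa [H] using hh
      conv_lhs => rw [← hh, evalInd_permVars, hu', evalInd_permVars]
    rw [h0, map_zero, eq_comm, mul_eq_zero, Nat.cast_eq_zero, Finset.card_eq_zero] at h1
    have h2 : (1 : Equiv.Perm (Fin m)) ∈ (∅ : Finset (Equiv.Perm (Fin m))) := by
      rw [← h1.resolve_right hsf]
      simp only [H, Finset.mem_filter, Finset.mem_univ, true_and]
      exact Finset.map_refl
    simp at h2

end Stabilizer

/-! ### Subrepresentations and intertwining maps under the group algebra. -/

section General

variable {k G V W : Type*} [CommSemiring k] [Monoid G] [AddCommMonoid V] [Module k V]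
  [AddCommMonoid W] [Module k W] {ρ : Representation k G V} {ρ' : Representation k G W}

theorem coe_asAlgebraHom_toRepresentation (σ : Subrepresentation ρ) (x : MonoidAlgebra k G)
    (v : σ.toSubmodule) :
    ((σ.toRepresentation.asAlgebraHom x v : σ.toSubmodule) : V) = ρ.asAlgebraHom x v := by
  induction x using MonoidAlgebra.induction_linear with
  | zero => simp
  | add x y hx hy => simp [map_add, hx, hy]
  | single g r =>
    rw [Representation.asAlgebraHom_single, Representation.asAlgebraHom_single]
    rfl

theorem asAlgebraHom_mem (σ : Subrepresentation ρ) (x : MonoidAlgebra k G) {v : V}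
    (hv : v ∈ σ.toSubmodule) : ρ.asAlgebraHom x v ∈ σ.toSubmodule := by
  rw [← coe_asAlgebraHom_toRepresentation σ x ⟨v, hv⟩]
  exact Subtype.property _

theorem map_asAlgebraHom (φ : Representation.IntertwiningMap ρ ρ') (x : MonoidAlgebra k G)
    (v : V) : φ (ρ.asAlgebraHom x v) = ρ'.asAlgebraHom x (φ v) := by
  induction x using MonoidAlgebra.induction_linear with
  | zero => simp
  | add x y hx hy => simp [map_add, hx, hy]
  | single g r =>
    rw [Representation.asAlgebraHom_single, Representation.asAlgebraHom_single,
      LinearMap.smul_apply, LinearMap.smul_apply, map_smul, φ.isIntertwining]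

theorem eq_of_irreducible_of_mem {k G V : Type*} [Field k] [Monoid G] [AddCommGroup V] [Module k V]
    {ρ : Representation k G V} {σ τ : Subrepresentation ρ}
    (hσ : σ.toRepresentation.IsIrreducible) (hτ : τ.toRepresentation.IsIrreducible) {v : V}
    (hv : v ≠ 0) (h1 : v ∈ σ.toSubmodule) (h2 : v ∈ τ.toSubmodule) : σ = τ := by
  have key : ∀ {σ τ : Subrepresentation ρ}, σ.toRepresentation.IsIrreducible →
      v ∈ σ.toSubmodule → v ∈ τ.toSubmodule → σ.toSubmodule ≤ τ.toSubmodule := by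
    intro σ τ hσ h1 h2
    -- The intersection with `τ`, seen inside `σ`, is nonzero because it contains `v`.
    let κ : Subrepresentation σ.toRepresentation :=
      ⟨τ.toSubmodule.comap σ.toSubmodule.subtype, fun g w hw => τ.apply_mem_toSubmodule g hw⟩
    rcases hσ.eq_bot_or_eq_top κ with h | h
    · have hm : (⟨v, h1⟩ : σ.toSubmodule) ∈ κ.toSubmodule := h2
      rw [h] at hm
      exact absurd (congrArg Subtype.val ((Submodule.mem_bot k).1 hm)) hv
    · intro w hw
      have hm : (⟨w, hw⟩ : σ.toSubmodule) ∈ κ.toSubmodule := by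
        rw [h]
        exact Submodule.mem_top
      exact hm
  exact Subrepresentation.toSubmodule_injective (le_antisymm (key hσ h1 h2) (key hτ h2 h1))

end General

/-! ### Irreducibility and non-isomorphism. -/

section Specht

variable {m p : ℕ} {hp : 2 * p ≤ m} (T : Numbering m (twoRow m p hp))

theorem coe_asAlgebraHom_spechtModule {μ : YoungDiagram} (T : Numbering m μ)
    (x : MonoidAlgebra ℂ (Equiv.Perm (Fin m))) (v : (spechtModule T).toSubmodule) :
    (((spechtModule T).toRepresentation.asAlgebraHom x v : (spechtModule T).toSubmodule) :
      MonoidAlgebra ℂ (Equiv.Perm (Fin m))) = x * v.1 :=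
  (coe_asAlgebraHom_toRepresentation _ x v).trans
    (Representation.asAlgebraHom_ofMulAction_smul_eq_mul x v.1)

theorem youngSymmetrizer_ne_zero : youngSymmetrizer T ≠ 0 := by
  intro h
  have := youngSymmetrizer_apply_topCells_ne_zero T le_rfl
  rw [h, map_zero] at this
  exact this rfl

/-- From any nonzero `w` of a subrepresentation one reaches the generator `c = c y w`, hence
everything. -/
theorem spechtModule_isIrreducible : (spechtModule T).toRepresentation.IsIrreducible where
  exists_pair_ne := by
    refine ⟨⊥, ⊤, fun h => youngSymmetrizer_ne_zero T ?_⟩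
    have hm : (⟨_, youngSymmetrizer_mem T⟩ : (spechtModule T).toSubmodule) ∈
        (⊤ : Subrepresentation (spechtModule T).toRepresentation).toSubmodule := Submodule.mem_top
    rw [← h] at hm
    exact congrArg Subtype.val ((Submodule.mem_bot ℂ).1 hm)
  eq_bot_or_eq_top κ := by
    by_cases hκ : ∀ w ∈ κ.toSubmodule, w = 0
    · left
      exact Subrepresentation.toSubmodule_injective ((Submodule.eq_bot_iff _).2 hκ)
    · right
      push Not at hκ
      obtain ⟨w, hw, hw0⟩ := hκ
      obtain ⟨y, hy⟩ := exists_youngSymmetrizer_mul_mul_eq T w.2 (fun h => hw0 (Subtype.ext h))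
      refine Subrepresentation.toSubmodule_injective ((Submodule.eq_top_iff').2 fun v => ?_)
      obtain ⟨x, hx⟩ := mem_spechtModule.1 v.2
      have : (spechtModule T).toRepresentation.asAlgebraHom
          (x * (youngSymmetrizer T * y)) w = v :=
        Subtype.ext ((coe_asAlgebraHom_spechtModule T _ w).trans (by rw [mul_assoc, hy, hx]))
      rw [← this]
      exact asAlgebraHom_mem κ _ hw

/-- Some `c_T y` fixes the nonzero vector `c_T`, yet it annihilates the whole left ideal of `c_U`.
-/
theorem isEmpty_equiv_spechtModule {q : ℕ} {hq : 2 * q ≤ m} (U : Numbering m (twoRow m q hq))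
    (hpq : p ≠ q) :
    IsEmpty ((spechtModule T).toRepresentation.Equiv (spechtModule U).toRepresentation) := by
  refine ⟨fun φ => ?_⟩
  let c : (spechtModule T).toSubmodule := ⟨_, youngSymmetrizer_mem T⟩
  obtain ⟨y, hy⟩ := exists_youngSymmetrizer_mul_mul_eq T c.2 (youngSymmetrizer_ne_zero T)
  have h1 : (spechtModule T).toRepresentation.asAlgebraHom (youngSymmetrizer T * y) c = c :=
    Subtype.ext ((coe_asAlgebraHom_spechtModule T _ c).trans hy)
  have h2 : φ.toIntertwiningMap c = 0 := by
    rw [← h1, map_asAlgebraHom]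
    refine Subtype.ext ((coe_asAlgebraHom_spechtModule U _ _).trans ?_)
    obtain ⟨x, hx⟩ := mem_spechtModule.1 (φ.toIntertwiningMap c).2
    rw [← hx, mul_assoc, ← mul_assoc y, ← mul_assoc, youngSymmetrizer_mul_mul_eq_zero T U hpq]
    rfl
  have h3 : c = 0 := φ.toLinearEquiv.injective (h2.trans (map_zero φ.toLinearEquiv).symm)
  exact youngSymmetrizer_ne_zero T (congrArg Subtype.val h3)

end Specht

/-! ### The isomorphism with the direct sum, and multiplicity freeness. -/

section Decomposition

variable {m k : ℕ} {hm : ∀ p : Fin (k + 1), 2 * (p : ℕ) ≤ m}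
  (T : ∀ p : Fin (k + 1), Numbering m (twoRow m (p : ℕ) (hm p)))

include hm in
theorem two_mul_le_of_forall_fin : 2 * k ≤ m := by
  simpa using hm (Fin.last k)

theorem card_topCells_of_fin {p : Fin (k + 1)} : (topCells (T p) k).card = k :=
  card_topCells (T p) (by have := two_mul_le_of_forall_fin (hm := hm); omega)

/-- The equivariant map `[m - p, p] → SF m k` sending `x` to `x` applied to the square-free monomial
in the first `k` letters of the first row. -/
noncomputable def spechtToSF (p : Fin (k + 1)) :
    (spechtModule (T p)).toSubmodule →ₗ[ℂ] (SF m k).toSubmodule :=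
  (((LinearMap.applyₗ (R := ℂ) (sqFreeMonomial (topCells (T p) k))).comp
    (algAct m).toLinearMap).comp (spechtModule (T p)).toSubmodule.subtype).codRestrict _
      fun x => algAct_mem_SF x.1 (sqFreeMonomial_mem_SF (card_topCells_of_fin T))

theorem coe_spechtToSF (p : Fin (k + 1)) (v : (spechtModule (T p)).toSubmodule) :
    (spechtToSF T p v : MvPolynomial (Fin m) ℂ) =
      algAct m v.1 (sqFreeMonomial (topCells (T p) k)) := rfl

theorem algAct_spechtToSF (p : Fin (k + 1)) (x : MonoidAlgebra ℂ (Equiv.Perm (Fin m)))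
    (v : (spechtModule (T p)).toSubmodule) :
    algAct m x (spechtToSF T p v) =
      spechtToSF T p ((spechtModule (T p)).toRepresentation.asAlgebraHom x v) := by
  rw [coe_spechtToSF, coe_spechtToSF, coe_asAlgebraHom_spechtModule, algAct_mul_apply]

open scoped DirectSum in
/-- The equivariant map from the sum of the `[m - p, p]` to `SF m k`. -/
noncomputable def sumToSF :
    (⨁ p, (spechtModule (T p)).toSubmodule) →ₗ[ℂ] (SF m k).toSubmodule :=
  ∑ p, spechtToSF T p ∘ₗ DirectSum.component ℂ _ _ p

open scoped DirectSum in
theorem sumToSF_apply (w : ⨁ p, (spechtModule (T p)).toSubmodule) :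
    sumToSF T w = ∑ p, spechtToSF T p (w p) := by
  rw [sumToSF, LinearMap.sum_apply]
  rfl

open scoped DirectSum in
/-- Applying a suitable element `c y` of the group algebra isolates the `p`-th component. -/
theorem exists_algAct_sumToSF (w : ⨁ p, (spechtModule (T p)).toSubmodule) {p : Fin (k + 1)}
    (hp : w p ≠ 0) :
    ∃ y, algAct m (youngSymmetrizer (T p) * y) (sumToSF T w) =
      algAct m (youngSymmetrizer (T p)) (sqFreeMonomial (topCells (T p) k)) := by
  obtain ⟨y, hy⟩ := exists_youngSymmetrizer_mul_mul_eq (T p) (w p).2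
    (fun h => hp (Subtype.ext h))
  refine ⟨y, ?_⟩
  rw [sumToSF_apply, Submodule.coe_sum, map_sum, Finset.sum_eq_single p]
  · rw [coe_spechtToSF, ← algAct_mul_apply, hy]
  · intro q _ hq
    obtain ⟨x, hx⟩ := mem_spechtModule.1 (w q).2
    rw [coe_spechtToSF, ← algAct_mul_apply, ← hx, mul_assoc, ← mul_assoc y, ← mul_assoc,
      youngSymmetrizer_mul_mul_eq_zero (T p) (T q) (fun h => hq (Fin.ext h.symm)), map_zero,
      LinearMap.zero_apply]
  · simp

open scoped DirectSum in
theorem apply_eq_zero_of_sumToSF_eq_zero {w : ⨁ p, (spechtModule (T p)).toSubmodule}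
    (hw : sumToSF T w = 0) (p : Fin (k + 1)) : w p = 0 := by
  by_contra hp
  obtain ⟨y, hy⟩ := exists_algAct_sumToSF T w hp
  rw [hw, ZeroMemClass.coe_zero, map_zero] at hy
  exact youngSymmetrizer_apply_topCells_ne_zero (T p) (by omega) hy.symm

theorem sumToSF_injective : Function.Injective (sumToSF T) := by
  intro w w' h
  have h0 : sumToSF T (w + (-1 : ℂ) • w') = 0 := by
    rw [map_add, map_smul, h]
    refine Subtype.ext ?_
    change (sumToSF T w' : MvPolynomial (Fin m) ℂ) + (-1 : ℂ) • (sumToSF T w').1 = 0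
    rw [neg_one_smul, add_neg_cancel]
  refine DFinsupp.ext fun p => ?_
  have h1 : (w p).1 + (-1 : ℂ) • (w' p).1 = 0 :=
    congrArg Subtype.val (apply_eq_zero_of_sumToSF_eq_zero T h0 p)
  rw [neg_one_smul, ← sub_eq_add_neg, sub_eq_zero] at h1
  exact Subtype.ext h1

theorem sumToSF_lof (p : Fin (k + 1)) (v : (spechtModule (T p)).toSubmodule) :
    sumToSF T (DirectSum.lof ℂ _ (fun p => (spechtModule (T p)).toSubmodule) p v) =
      spechtToSF T p v := by
  rw [sumToSF_apply, Finset.sum_eq_single p]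
  · exact congrArg _ (DirectSum.of_eq_same (β := fun p => (spechtModule (T p)).toSubmodule) p v)
  · intro q _ hq
    exact (congrArg _ (DirectSum.of_eq_of_ne (β := fun p => (spechtModule (T p)).toSubmodule)
      p q v hq)).trans (map_zero _)
  · simp

open scoped DirectSum in
theorem sumToSF_isIntertwining (g : Equiv.Perm (Fin m)) :
    sumToSF T ∘ₗ (Representation.directSum fun p => (spechtModule (T p)).toRepresentation) g =
      (SF m k).toRepresentation g ∘ₗ sumToSF T := by
  refine DirectSum.linearMap_ext ℂ fun p => LinearMap.ext fun v => ?_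
  simp only [LinearMap.comp_apply]
  have h1 : (Representation.directSum fun p => (spechtModule (T p)).toRepresentation) g
      (DirectSum.lof ℂ _ (fun p => (spechtModule (T p)).toSubmodule) p v) =
      DirectSum.lof ℂ _ (fun p => (spechtModule (T p)).toSubmodule) p
        ((spechtModule (T p)).toRepresentation g v) :=
    DirectSum.lmap_lof _ _ _
  rw [h1, sumToSF_lof, sumToSF_lof]
  refine Subtype.ext ?_
  have h2 := algAct_spechtToSF T p (MonoidAlgebra.single g 1) v
  rw [algAct_single_one, Representation.asAlgebraHom_single_one] at h2
  exact h2.symm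

theorem sumToSF_surjective : Function.Surjective (sumToSF T) := by
  obtain ⟨u, -, hu⟩ := Finset.exists_subset_card_eq
    (show k ≤ (Finset.univ : Finset (Fin m)).card by rw [Finset.card_fin]; have := two_mul_le_of_forall_fin (hm := hm); omega)
  have hv (p : Fin (k + 1)) : ∃ v : (spechtModule (T p)).toSubmodule, v ≠ 0 ∧
      (spechtToSF T p v : MvPolynomial (Fin m) ℂ) ∈ invariantsSF k u := by
    let c : (spechtModule (T p)).toSubmodule := ⟨_, youngSymmetrizer_mem (T p)⟩
    obtain ⟨x, hx, hx0⟩ := exists_algAct_mem_invariantsSF hu (spechtToSF T p c).2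
      (youngSymmetrizer_apply_topCells_ne_zero (T p) (by omega))
    rw [algAct_spechtToSF] at hx hx0
    refine ⟨_, fun h => hx0 ?_, hx⟩
    rw [h, map_zero]
    rfl
  choose v hv0 hv using hv
  let b : Fin (k + 1) → invariantsSF k u := fun p => ⟨_, hv p⟩
  -- The `b p` come from different summands of the direct sum, so injectivity of `sumToSF` makes
  -- them independent.
  have hb : LinearIndependent ℂ b := by
    rw [Fintype.linearIndependent_iff]
    intro a ha p
    have h1 : sumToSF T (∑ p, a p •
        DirectSum.lof ℂ _ (fun p => (spechtModule (T p)).toSubmodule) p (v p)) = 0 := by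
      rw [map_sum]
      simp only [map_smul, sumToSF_lof]
      refine Subtype.ext ?_
      have := congrArg Subtype.val ha
      simpa [b] using this
    have h3 := apply_eq_zero_of_sumToSF_eq_zero T h1 p
    rw [DFinsupp.finsetSum_apply, Finset.sum_eq_single p] at h3
    · have h4 : a p • v p = 0 := by
        rwa [DFinsupp.smul_apply, DirectSum.lof_eq_of, DirectSum.of_eq_same] at h3
      exact (smul_eq_zero.1 h4).resolve_right (hv0 p)
    · intro q _ hq
      rw [DFinsupp.smul_apply, DirectSum.lof_eq_of]
      have := DirectSum.of_eq_of_ne (β := fun p => (spechtModule (T p)).toSubmodule) q p (v q) hq.symm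
      rw [this, smul_zero]
    · simp
  obtain ⟨hfin, hle⟩ := finrank_invariantsSF_le (k := k) u
  -- There are `k + 1` independent vectors in a space of dimension at most `k + 1`.
  have htop : Submodule.span ℂ (Set.range b) = ⊤ := by
    refine hb.span_eq_top_of_card_eq_finrank (le_antisymm hb.fintype_card_le_finrank ?_)
    simpa using hle
  let R : Submodule ℂ (MvPolynomial (Fin m) ℂ) :=
    (LinearMap.range (sumToSF T)).map (SF m k).toSubmodule.subtype
  have hR (g : Equiv.Perm (Fin m)) : ∀ f ∈ R, permVars m g f ∈ R := by
    rintro _ ⟨_, ⟨w, rfl⟩, rfl⟩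
    exact ⟨_, ⟨_, LinearMap.congr_fun (sumToSF_isIntertwining T g) w⟩, rfl⟩
  have hinv : invariantsSF k u ≤ R := by
    have h1 : Submodule.span ℂ (Set.range b) ≤ R.comap (invariantsSF k u).subtype := by
      refine Submodule.span_le.2 ?_
      rintro _ ⟨p, rfl⟩
      exact ⟨_, ⟨_, sumToSF_lof T p (v p)⟩, rfl⟩
    intro f hf
    have h2 : (⟨f, hf⟩ : invariantsSF k u) ∈ Submodule.span ℂ (Set.range b) := by
      rw [htop]
      exact Submodule.mem_top
    exact h1 h2
  -- The monomial of `u` is itself invariant, and its translates span `SF`.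
  have hmon : sqFreeMonomial u ∈ R := hinv
    ⟨sqFreeMonomial_mem_SF hu, fun h hh => by rw [permVars_sqFreeMonomial, hh]⟩
  have hall : (SF m k).toSubmodule ≤ R := by
    refine Submodule.span_le.2 ?_
    rintro _ ⟨s, hs, rfl⟩
    obtain ⟨g, -, rfl⟩ := exists_perm_map_eq_pair (u := ∅) (hu.trans hs.symm) (by simp)
    rw [← permVars_sqFreeMonomial]
    exact hR g _ hmon
  intro f
  obtain ⟨_, ⟨w, rfl⟩, hw⟩ := hall f.2
  exact ⟨w, Subtype.ext hw⟩

-- A nonzero vector of `σ` has a nonzero component at some `p`, so some `x = c y` acts on `σ`, and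
-- by the isomorphism on `τ`, as a nonzero operator. Its values lie on the line `c SF`, so both
-- contain the generator `e` of that line and coincide by irreducibility.
include T in
theorem multiplicityFree_SF : MultiplicityFree (SF m k).toRepresentation := by
  rintro σ τ hσ hτ ⟨φ⟩
  obtain ⟨v, hv0⟩ : ∃ v : σ.toSubmodule, v ≠ 0 := by
    by_contra! H
    refine bot_ne_top (α := Subrepresentation σ.toRepresentation)
      (Subrepresentation.toSubmodule_injective ?_)
    exact Submodule.ext fun v => by rw [H v]; simp
  obtain ⟨w, hw⟩ := sumToSF_surjective T v.1
  obtain ⟨p, hp⟩ : ∃ p, w p ≠ 0 := by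
    by_contra! H
    have : w = 0 := DFinsupp.ext H
    rw [this, map_zero] at hw
    exact hv0 (Subtype.ext hw.symm)
  obtain ⟨y, hy⟩ := exists_algAct_sumToSF T w hp
  have hne := youngSymmetrizer_apply_topCells_ne_zero (T p) (k := k) (by omega)
  set x := youngSymmetrizer (T p) * y with hx
  have hcoe (κ : Subrepresentation (SF m k).toRepresentation) (z : κ.toSubmodule) :
      (((κ.toRepresentation.asAlgebraHom x z : κ.toSubmodule) : (SF m k).toSubmodule) :
        MvPolynomial (Fin m) ℂ) = algAct m x z.1.1 :=
    (congrArg Subtype.val (coe_asAlgebraHom_toRepresentation κ x z)).trans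
      (coe_asAlgebraHom_toRepresentation (SF m k) x z.1)
  let e : (SF m k).toSubmodule := ⟨_, algAct_mem_SF (youngSymmetrizer (T p))
    (sqFreeMonomial_mem_SF (card_topCells_of_fin T (p := p)))⟩
  have he (κ : Subrepresentation (SF m k).toRepresentation) (z : κ.toSubmodule)
      (hz : κ.toRepresentation.asAlgebraHom x z ≠ 0) : e ∈ κ.toSubmodule := by
    have h1 := youngSymmetrizer_apply_mem_span (T p) (k := k) (by omega)
      (by have := two_mul_le_of_forall_fin (hm := hm); omega)
      (algAct_mem_SF y z.1.2)
    rw [← algAct_mul_apply, ← hx, ← hcoe] at h1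
    obtain ⟨r, hr⟩ := Submodule.mem_span_singleton.1 h1
    have hr0 : r ≠ 0 := by
      rintro rfl
      rw [zero_smul] at hr
      exact hz (Subtype.ext (Subtype.ext hr.symm))
    have h2 : e = r⁻¹ • (κ.toRepresentation.asAlgebraHom x z).1 := by
      refine Subtype.ext ?_
      change algAct m (youngSymmetrizer (T p)) (sqFreeMonomial (topCells (T p) k)) = r⁻¹ • _
      rw [← hr, smul_smul, inv_mul_cancel₀ hr0, one_smul]
    rw [h2]
    exact κ.toSubmodule.smul_mem _ (Subtype.property _)
  have hσ0 : σ.toRepresentation.asAlgebraHom x v ≠ 0 := by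
    intro h
    have := hcoe σ v
    rw [h, ← hw, hy] at this
    exact hne this.symm
  have hτ0 : τ.toRepresentation.asAlgebraHom x (φ.toIntertwiningMap v) ≠ 0 := by
    rw [← map_asAlgebraHom]
    intro h
    exact hσ0 (φ.toLinearEquiv.injective (h.trans (map_zero φ.toLinearEquiv).symm))
  exact eq_of_irreducible_of_mem hσ hτ (v := e) (fun h => hne (congrArg Subtype.val h))
    (he σ _ hσ0) (he τ _ hτ0)

end Decomposition
end SymRep

theorem proposition4p3 (m k : ℕ) (hmk : 2 * k ≤ m)
    (T : ∀ p : Fin (k + 1), SymRep.Numbering m (SymRep.twoRow m (p : ℕ) (by omega))) :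
    (∀ p, (SymRep.spechtModule (T p)).toRepresentation.IsIrreducible) ∧
    (∀ p q, p ≠ q → IsEmpty ((SymRep.spechtModule (T p)).toRepresentation.Equiv
      (SymRep.spechtModule (T q)).toRepresentation)) ∧
    SymRep.MultiplicityFree (SymRep.SF m k).toRepresentation ∧
    Nonempty ((SymRep.SF m k).toRepresentation.Equiv
      (Representation.directSum fun p => (SymRep.spechtModule (T p)).toRepresentation)) := by
  refine ⟨fun p => SymRep.spechtModule_isIrreducible (T p), fun p q hpq =>
    SymRep.isEmpty_equiv_spechtModule (T p) (T q) (fun h => hpq (Fin.ext h)),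
    SymRep.multiplicityFree_SF T, ⟨Representation.Equiv.symm ?_⟩⟩
  exact Representation.Equiv.mk
    (LinearEquiv.ofBijective (SymRep.sumToSF T)
      ⟨SymRep.sumToSF_injective T, SymRep.sumToSF_surjective T⟩)
    (SymRep.sumToSF_isIntertwining T)
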